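/- Let $n \ge 0$ be an integer, let $u_1, \dots, u_n$ be the standard basis of $\mathbb{R}^n$, and let $c^-_{pq}, c^+_{pq}$ ($1 \le p < q \le n$) be arbitrary real numbers. For $p<q$ let $\sigma_{pq}$ be the reflection of $\mathbb{R}^n$ with $\sigma_{pq}(u_p) = u_q$, $\sigma_{pq}(u_q) = u_p$, $\sigma_{pq}(u_i) = u_i$ for $i \ne p,q$, and let $\tau_{pq}$ be the reflection with $\tau_{pq}(u_p) = -u_q$, $\tau_{pq}(u_q) = -u_p$, $\tau_{pq}(u_i) = u_i$ for $i \ne p,q$. Then the characteristic polynomial $\det(t\cdot 1 - M)$ of the operator $$M = \sum_{1 \le p < q \le n} \bigl( c_{pq}^-(1 - \sigma_{pq}) + c_{pq}^+(1 - \tau_{pq}) \bigr)$$ is equal to $\sum_{k=0}^n (-1)^k \mu_k t^{n-k}$, where $$\mu_k = \sum_{\ell \ge 0}\ \sum_{F \in \mathcal{MFD}_{n,k,\ell}} 4^{\ell} \prod_{(pq)_s \text{ is an edge of } F} c_{pq}^s \prod_{i=1}^{n-k} (m_i+1).$$ Here every pair of vertices $p<q$ in $\{1,\dots,n\}$ may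 be joined by two possible edges, a $-$-edge $(pq)_-$ and a $+$-edge $(pq)_+$; a graph $F$ on the vertices $1, \dots, n$ is a set of such edges (so $(pq)_-$ and $(pq)_+$ may both occur in $F$, and then form a cycle of length $2$). A graph is a mixed forest if every connected component of it is either a tree (an isolated vertex included) or a graph with one cycle, that is, a connected graph with as many vertices as edges. $\mathcal{MFD}_{n,k,\ell}$ is the set of mixed forests on the vertices $1,\dots,n$ with $k$ edges, $n-k$ tree components and $\ell$ one-cycle components such that the number of $+$-edges in every cycle is odd; $m_1,\dots,m_{n-k}$ are the numbers of edges of the tree components of $F$. -/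

import Mathlib

open Polynomial

noncomputable section

namespace TypeD

/-- The standard basis vector `u_i` of `ℝⁿ`. -/
def u {n : ℕ} (i : Fin n) : Fin n → ℝ := Pi.single i 1

/-- The reflection `σ_pq` : `u_p ↦ u_q`, `u_q ↦ u_p`, and `u_i ↦ u_i` for all other `i`. -/
def sigma {n : ℕ} (p q : Fin n) : Module.End ℝ (Fin n → ℝ) :=
  (Pi.basisFun ℝ (Fin n)).constr ℝ
    fun i => if i = p then u q else if i = q then u p else u i

/-- The reflection `τ_pq` : `u_p ↦ -u_q`, `u_q ↦ -u_p`, and `u_i ↦ u_i` for all other `i`. -/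
def tau {n : ℕ} (p q : Fin n) : Module.End ℝ (Fin n → ℝ) :=
  (Pi.basisFun ℝ (Fin n)).constr ℝ
    fun i => if i = p then -u q else if i = q then -u p else u i

/-- The operator `M = ∑_{p < q} (c⁻_pq (1 - σ_pq) + c⁺_pq (1 - τ_pq))`. -/
def operator {n : ℕ} (cminus cplus : Fin n → Fin n → ℝ) : Module.End ℝ (Fin n → ℝ) :=
  ∑ p : Fin n, ∑ q ∈ Finset.Ioi p,
    (cminus p q • (1 - sigma p q) + cplus p q • (1 - tau p q))

/-- A signed edge `(pq)_s` with `p < q`; it is stored as `(p, q, s)`, where `s = true` means a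
`+`-edge and `s = false` means a `-`-edge. Every pair of vertices is thus joined by exactly two
possible edges, and there are no loops. -/
abbrev SignedEdge (n : ℕ) : Type := {e : Fin n × Fin n × Bool // e.1 < e.2.1}

namespace SignedEdge

variable {n : ℕ}

/-- The smaller end of a signed edge. -/
def fst (e : SignedEdge n) : Fin n := e.1.1

/-- The larger end of a signed edge. -/
def snd (e : SignedEdge n) : Fin n := e.1.2.1

/-- The sign of a signed edge. -/
def isPlus (e : SignedEdge n) : Bool := e.1.2.2

/-- The edge `e` joins the vertices `a` and `b`. -/
def Joins (e : SignedEdge n) (a b : Fin n) : Prop :=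
  (e.fst = a ∧ e.snd = b) ∨ (e.fst = b ∧ e.snd = a)

/-- The weight `c^s_pq` of the edge `(pq)_s`. -/
def weight (cminus cplus : Fin n → Fin n → ℝ) (e : SignedEdge n) : ℝ :=
  if e.isPlus then cplus e.fst e.snd else cminus e.fst e.snd

end SignedEdge

/-- A signed graph with the vertices `1, …, n`, given by its set of signed edges. -/
abbrev SignedGraph (n : ℕ) : Type := Finset (SignedEdge n)

namespace SignedGraph

variable {n : ℕ}

/-- The simple graph on the same vertices: two distinct vertices are adjacent if some edge of `F`
joins them. It has the same connected components as `F`. -/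
def toSimpleGraph (F : SignedGraph n) : SimpleGraph (Fin n) :=
  SimpleGraph.fromRel fun a b => ∃ e ∈ F, e.Joins a b

/-- The connected components of `F` (isolated vertices included). -/
abbrev Component (F : SignedGraph n) : Type := F.toSimpleGraph.ConnectedComponent

/-- The set of edges of `F` that lie in the component `K`. -/
def edgesOf (F : SignedGraph n) (K : F.Component) : Finset (SignedEdge n) :=
  open Classical in F.filter fun e => F.toSimpleGraph.connectedComponentMk e.fst = K

/-- `Z` is the edge set of a cycle: for some `m = k + 2 ≥ 2` there are distinct vertices
`v_0, …, v_{m-1}` and distinct edges `e_0, …, e_{m-1}`, where `e_i` joins `v_i` with `v_{i+1}`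
(indices modulo `m`), and `Z = {e_0, …, e_{m-1}}`. The two edges `(pq)_-` and `(pq)_+`
form a cycle with `m = 2`. -/
def IsCycle (Z : Finset (SignedEdge n)) : Prop :=
  ∃ (k : ℕ) (v : Fin (k + 2) → Fin n) (e : Fin (k + 2) → SignedEdge n),
    Function.Injective v ∧ Function.Injective e ∧
      (∀ i, (e i).Joins (v i) (v (i + 1))) ∧ Z = Finset.univ.image e

/-- The component `K` is a tree: it (is connected and) contains no cycles. -/
def IsTree (F : SignedGraph n) (K : F.Component) : Prop :=
  ∀ Z ⊆ F.edgesOf K, ¬ IsCycle Z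

/-- The component `K` is a graph with one cycle: it (is connected and) has as many vertices as
edges. -/
def IsOneCycle (F : SignedGraph n) (K : F.Component) : Prop :=
  K.supp.ncard = (F.edgesOf K).card

/-- A mixed forest: every connected component is either a tree or a graph with one cycle. -/
def IsMixedForest (F : SignedGraph n) : Prop :=
  ∀ K : F.Component, F.IsTree K ∨ F.IsOneCycle K

/-- In every cycle of `F` the number of `+`-edges is odd. -/
def OddCycles (F : SignedGraph n) : Prop :=
  ∀ Z ⊆ F, IsCycle Z → Odd (Z.filter fun e => e.isPlus = true).card

open Classical in
/-- The set of the tree components of `F`. -/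
def treeComponents (F : SignedGraph n) : Finset F.Component :=
  (Set.toFinite {K : F.Component | F.IsTree K}).toFinset

open Classical in
/-- The set of the one-cycle components of `F`. -/
def oneCycleComponents (F : SignedGraph n) : Finset F.Component :=
  (Set.toFinite {K : F.Component | F.IsOneCycle K}).toFinset

end SignedGraph

open Classical in
/-- The set of mixed forests on the vertices `1, …, n` with `k` signed edges, `n - k` tree
components and `l` one-cycle components, such that every cycle contains an odd number of
`+`-edges. -/
def MFD (n k l : ℕ) : Finset (SignedGraph n) :=
  Finset.univ.filter fun F =>
    F.IsMixedForest ∧ F.OddCycles ∧ F.card = k ∧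
      F.treeComponents.card + k = n ∧ F.oneCycleComponents.card = l

/-- The sum `μ_k`, over all `l` and all `F ∈ MFD n k l`, of the weights
`4 ^ l * ∏_{(pq)_s ∈ F} c^s_pq * ∏_i (m_i + 1)`, where `m_i` is the number of edges in the `i`-th
tree component. (A mixed forest on `n` vertices has at most `n` components.) -/
def mu {n : ℕ} (cminus cplus : Fin n → Fin n → ℝ) (k : ℕ) : ℝ :=
  ∑ l ∈ Finset.range (n + 1), ∑ F ∈ MFD n k l,
    4 ^ l * (∏ e ∈ F, SignedEdge.weight cminus cplus e) *
      ∏ K ∈ F.treeComponents, (((F.edgesOf K).card : ℝ) + 1)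

end TypeD

end

open Matrix

/-! Each reflection summand has rank one: `1 - σ_pq` is `x ↦ ⟨x, v⟩ v` with `v = u_p - u_q`, and `1
- τ_pq` the same with `v = u_p + u_q`. Hence `M = B W Bᵀ`, where the columns of `B` are these
vectors for all signed edges and `W` is the diagonal matrix of the weights. Since `B (W Bᵀ)` and `(W
Bᵀ) B` have the same characteristic polynomial up to a power of `t`, the coefficient of `t^(n-k)` is
`(-1)^k` times the sum of the principal `k × k` minors of `W Bᵀ B`. The minor of a set `F` of `k`
edges is the product of its weights times the Gram determinant of its columns
(`coeff_charpoly_operator`).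

This Gram matrix is block diagonal over the components of `F`. A component with more edges than
vertices gives `0`, a tree with `m` edges gives `m + 1`, and a one-cycle component gives `4` if its
cycle has an odd number of `+`-edges. Any cycle with an even number of them makes the columns
dependent.

The values `m + 1` and `4` come from one identity, `sq_det_gram_of_vecMul_eq_zero`. For a connected
graph with one edge fewer than vertices, let `g` be the Gram determinant of its columns `B` and `s`
a nonzero vector orthogonal to them; its entries are `±c`. Then `(g (s·t))² = g (s·s) Gram[B|t]` for
every extra column `t`. A unit vector `t` has `Gram[B|t] = 1`, so `g` is the number of vertices. The
column `t` of a further edge has `s·t ∈ {0, ±2c}`, so `Gram[B|t]` is `0` or `4`. -/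

/-- The signed incidence matrix of a multigraph with vertex set `V`, edge set `E`, end maps `a`, `b`
and signs `ε`: the column of the edge `e` is `u_{a e} - ε e • u_{b e}`. -/
def signedIncidence {V E : Type*} [DecidableEq V] (a b : E → V) (ε : E → ℤˣ) : Matrix V E ℤ :=
  Matrix.of fun v e => (if v = a e then 1 else 0) - (ε e : ℤ) * (if v = b e then 1 else 0)

/-- A cycle with `k + 2` vertices in the multigraph with end maps `a`, `b`. -/
structure IsCyclicWalk {V E : Type*} (a b : E → V) {k : ℕ} (v : Fin (k + 2) → V)
    (e : Fin (k + 2) → E) : Prop where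
  injective_vertices : Function.Injective v
  injective_edges : Function.Injective e
  joins : ∀ i, s(a (e i), b (e i)) = s(v i, v (i + 1))

/-! ### Propagation along the edges of a connected multigraph -/

section Connected

variable {V E : Type*}

/-- `G` need not contain every edge of the multigraph: it is enough that each adjacency of `G` is
realised by some edge, so `G` may be a spanning tree. -/
lemma forall_vertex_of_connected (a b : E → V) {G : SimpleGraph V} (hG : G.Connected)
    (hr : ∀ x y, G.Adj x y → ∃ e, s(a e, b e) = s(x, y)) {P : V → Prop}
    (hP : ∀ e, P (a e) ↔ P (b e)) {r : V} (h : P r) (v : V) : P v := by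
  obtain ⟨p⟩ := hG.preconnected r v
  induction p with
  | nil => exact h
  | cons hadj p ih =>
    apply ih
    obtain ⟨e, he⟩ := hr _ _ hadj
    have := hP e
    rcases Sym2.eq_iff.mp he with ⟨h1, h2⟩ | ⟨h1, h2⟩ <;> rw [h1, h2] at this <;> tauto

end Connected

/-! ### Gram determinants of integer matrices -/

section LinearAlgebra

variable {V E : Type*} [Fintype V] [Fintype E]

lemma exists_ne_zero_mulVec_eq_zero (A : Matrix V E ℤ) (h : Fintype.card V < Fintype.card E) :
    ∃ x : E → ℤ, x ≠ 0 ∧ A *ᵥ x = 0 := by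
  by_contra! hA
  have hinj : Function.Injective A.mulVecLin := by
    rw [← LinearMap.ker_eq_bot, LinearMap.ker_eq_bot']
    intro x hx
    by_contra hne
    exact hA x hne hx
  exact absurd (card_le_of_injective ℤ A.mulVecLin hinj) (not_le.mpr h)

/-- `x · AᵀAx` is the sum of squares `Ax · Ax`, which vanishes over `ℤ` only for `Ax = 0`. -/
lemma transpose_mul_self_mulVec_eq_zero (A : Matrix V E ℤ) (x : E → ℤ) :
    (Aᵀ * A) *ᵥ x = 0 ↔ A *ᵥ x = 0 := by
  constructor
  · intro h
    have h2 : (A *ᵥ x) ⬝ᵥ (A *ᵥ x) = 0 := by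
      rw [dotProduct_mulVec, ← mulVec_transpose, mulVec_mulVec, h, zero_dotProduct]
    exact dotProduct_self_eq_zero.mp h2
  · intro h
    rw [← mulVec_mulVec, h, mulVec_zero]

lemma det_gram_eq_zero_iff [DecidableEq E] (A : Matrix V E ℤ) :
    (Aᵀ * A).det = 0 ↔ ∃ x : E → ℤ, x ≠ 0 ∧ A *ᵥ x = 0 := by
  rw [← exists_mulVec_eq_zero_iff]
  simp only [transpose_mul_self_mulVec_eq_zero, ne_eq]

lemma det_gram_eq_zero_of_card_lt [DecidableEq E] (A : Matrix V E ℤ)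
    (h : Fintype.card V < Fintype.card E) : (Aᵀ * A).det = 0 :=
  (det_gram_eq_zero_iff A).mpr (exists_ne_zero_mulVec_eq_zero A h)

/-- For two matrices that become square after reindexing, `det (Aᵀ B)` squared is the product of the
Gram determinants. -/
lemma sq_det_transpose_mul [DecidableEq V] [DecidableEq E] (φ : E ≃ V) (A B : Matrix V E ℤ) :
    (Aᵀ * B).det ^ 2 = (Aᵀ * A).det * (Bᵀ * B).det := by
  have key : ∀ C D : Matrix V E ℤ, (Cᵀ * D).det =
      (C.submatrix φ id).det * (D.submatrix φ id).det := by
    intro C D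
    rw [← det_transpose (C.submatrix φ id), ← det_mul]
    congr 1
    rw [transpose_submatrix, submatrix_mul_equiv, submatrix_id_id]
  rw [key, key, key]
  ring

/-- Apply `sq_det_transpose_mul` to the square matrices `[B|s]` and `[B|t]`. As `s` is orthogonal to
the columns of `B`, the mixed product `[B|s]ᵀ[B|t]` is block triangular with determinant `det (BᵀB)
(s·t)`; the case `t = s` gives the Gram determinant of `[B|s]`. -/
lemma sq_det_gram_of_vecMul_eq_zero [DecidableEq V] [DecidableEq E]
    (φ : E ⊕ Unit ≃ V) (B : Matrix V E ℤ) (s t : V → ℤ) (hs : s ᵥ* B = 0) :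
    ((Bᵀ * B).det * (s ⬝ᵥ t)) ^ 2 =
      (Bᵀ * B).det * (s ⬝ᵥ s) *
        ((fromCols B (replicateCol Unit t))ᵀ * fromCols B (replicateCol Unit t)).det := by
  have h0 : (replicateCol Unit s)ᵀ * B = 0 := by
    ext i j
    simpa [mul_apply, vecMul, dotProduct] using congrFun hs j
  have h1 : ∀ t : V → ℤ, (fromCols B (replicateCol Unit s))ᵀ * fromCols B (replicateCol Unit t) =
      fromBlocks (Bᵀ * B) (Bᵀ * replicateCol Unit t) 0 (of fun _ _ => s ⬝ᵥ t) := by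
    intro t
    rw [transpose_fromCols, fromRows_mul_fromCols, h0]
    congr 1
  have h2 : ∀ t : V → ℤ,
      ((fromCols B (replicateCol Unit s))ᵀ * fromCols B (replicateCol Unit t)).det =
      (Bᵀ * B).det * (s ⬝ᵥ t) := by
    intro t
    rw [h1, det_fromBlocks_zero₂₁, det_unique (n := Unit)]
    rfl
  rw [← h2, ← h2, ← sq_det_transpose_mul φ]

lemma exists_ne_zero_vecMul_eq_zero (A : Matrix V E ℤ)
    (h : Fintype.card E < Fintype.card V) : ∃ s : V → ℤ, s ≠ 0 ∧ s ᵥ* A = 0 := by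
  simpa only [mulVec_transpose] using exists_ne_zero_mulVec_eq_zero Aᵀ h

lemma nonempty_equiv_of_card (h : Fintype.card V = Fintype.card E + 1) :
    Nonempty (E ⊕ Unit ≃ V) :=
  Fintype.card_eq.mp (by simp [h])

lemma dotProduct_self_of_sq_eq {s : V → ℤ} {c : ℤ} (h : ∀ v, s v ^ 2 = c ^ 2) :
    s ⬝ᵥ s = Fintype.card V * c ^ 2 := by
  simp [dotProduct, ← sq, h]

end LinearAlgebra

/-! ### Signed incidence matrices and the Gram determinant of a tree -/

section Incidence

variable {V E : Type*} [DecidableEq V] (a b : E → V) (ε : E → ℤˣ)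

lemma vecMul_signedIncidence [Fintype V] (s : V → ℤ) (e : E) :
    (s ᵥ* signedIncidence a b ε) e = s (a e) - ε e * s (b e) := by
  simp [vecMul, dotProduct, signedIncidence, mul_sub, Finset.sum_sub_distrib, mul_comm]

lemma signedIncidence_col (e : E) :
    (fun v => signedIncidence a b ε v e) =
      Pi.single (a e) 1 - (ε e : ℤ) • Pi.single (b e) (1 : ℤ) := by
  ext v
  simp [signedIncidence, Pi.single_apply]

/-- Orthogonality to the column of `e` says `s (a e) = ± s (b e)`, so the square is constant along
edges. -/
lemma sq_eq_of_vecMul_eq_zero [Fintype V] {G : SimpleGraph V} (hG : G.Connected)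
    (hr : ∀ x y, G.Adj x y → ∃ e, s(a e, b e) = s(x, y)) {s : V → ℤ}
    (hs : s ᵥ* signedIncidence a b ε = 0) (r v : V) : s v ^ 2 = s r ^ 2 := by
  refine forall_vertex_of_connected a b hG hr (P := fun v => s v ^ 2 = s r ^ 2) ?_ rfl v
  intro e
  have h := congrFun hs e
  rw [vecMul_signedIncidence, Pi.zero_apply, sub_eq_zero] at h
  have h2 : s (a e) ^ 2 = s (b e) ^ 2 := by
    rw [h]
    rcases Int.units_eq_one_or (ε e) with h1 | h1 <;> simp [h1]
  simp only [h2]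

/-- The columns of a connected multigraph, together with one unit vector, span `ℤ^V`. -/
lemma exists_mulVec_eq_single [Fintype V] [Fintype E] {G : SimpleGraph V} (hG : G.Connected)
    (hr : ∀ x y, G.Adj x y → ∃ e, s(a e, b e) = s(x, y)) (r v : V) :
    ∃ x, fromCols (signedIncidence a b ε) (replicateCol Unit (Pi.single r 1)) *ᵥ x =
      Pi.single v 1 := by
  classical
  set A := fromCols (signedIncidence a b ε) (replicateCol Unit (Pi.single r (1 : ℤ)))
  refine forall_vertex_of_connected a b hG hr
    (P := fun v => ∃ x, A *ᵥ x = Pi.single v 1) ?_ (r := r) ?_ v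
  · intro e
    have hcol : A *ᵥ Pi.single (Sum.inl e) 1 =
        Pi.single (a e) 1 - (ε e : ℤ) • Pi.single (b e) (1 : ℤ) := by
      rw [mulVec_single_one, ← signedIncidence_col]
      rfl
    have hε : (ε e : ℤ) * ε e = 1 := by
      rcases Int.units_eq_one_or (ε e) with h1 | h1 <;> simp [h1]
    constructor
    · rintro ⟨x, hx⟩
      refine ⟨(ε e : ℤ) • (x - Pi.single (Sum.inl e) 1), ?_⟩
      rw [mulVec_smul, mulVec_sub, hcol, hx, sub_sub_cancel, smul_smul, hε, one_smul]
    · rintro ⟨x, hx⟩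
      refine ⟨(ε e : ℤ) • x + Pi.single (Sum.inl e) 1, ?_⟩
      rw [mulVec_add, mulVec_smul, hcol, hx]
      abel
  · refine ⟨Pi.single (Sum.inr ()) 1, ?_⟩
    rw [mulVec_single_one]
    rfl

/-- The columns span `ℤ^V`, so the square matrix has an integral right inverse. Its determinant is a
unit of `ℤ`, and the Gram determinant is the square of it. -/
lemma det_gram_fromCols_single [Fintype V] [Fintype E] [DecidableEq E] {G : SimpleGraph V}
    (hG : G.Connected) (hr : ∀ x y, G.Adj x y → ∃ e, s(a e, b e) = s(x, y))
    (φ : E ⊕ Unit ≃ V) (r : V) :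
    ((fromCols (signedIncidence a b ε) (replicateCol Unit (Pi.single r 1)))ᵀ *
      fromCols (signedIncidence a b ε) (replicateCol Unit (Pi.single r 1))).det = 1 := by
  set A := fromCols (signedIncidence a b ε) (replicateCol Unit (Pi.single r (1 : ℤ)))
  choose x hx using exists_mulVec_eq_single a b ε hG hr r
  have h1 : A.submatrix φ id * (of fun i j => x j i).submatrix id φ = 1 := by
    ext i j
    have := congrFun (hx (φ j)) (φ i)
    simpa [A, mul_apply, mulVec, dotProduct, one_apply, Pi.single_apply] using this
  have h2 := congrArg det h1
  rw [det_mul, det_one] at h2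
  have h3 : IsUnit (A.submatrix φ id).det := IsUnit.of_mul_eq_one _ h2
  have h4 : Aᵀ * A = (A.submatrix φ id)ᵀ * A.submatrix φ id := by
    rw [transpose_submatrix, submatrix_mul_equiv, submatrix_id_id]
  rw [h4, det_mul, det_transpose]
  rcases Int.isUnit_iff.mp h3 with h | h <;> rw [h] <;> rfl

/-- A kernel vector of a connected signed graph has entries of constant nonzero square. -/
lemma exists_vecMul_eq_zero_of_connected [Fintype V] [Fintype E] {G : SimpleGraph V}
    (hG : G.Connected) (hr : ∀ x y, G.Adj x y → ∃ e, s(a e, b e) = s(x, y))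
    (h : Fintype.card E < Fintype.card V) :
    ∃ (s : V → ℤ) (c : ℤ), c ≠ 0 ∧ s ᵥ* signedIncidence a b ε = 0 ∧ ∀ v, s v ^ 2 = c ^ 2 := by
  obtain ⟨s, hs0, hs⟩ := exists_ne_zero_vecMul_eq_zero (signedIncidence a b ε) h
  obtain ⟨r, hr0⟩ := Function.ne_iff.mp hs0
  exact ⟨s, s r, hr0, hs, fun v => sq_eq_of_vecMul_eq_zero a b ε hG hr hs r v⟩

/-- The Gram determinant of a signed tree is its number of vertices. -/
theorem det_gram_signedIncidence_of_card_eq_add_one [Fintype V] [Fintype E] [DecidableEq E]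
    {G : SimpleGraph V} (hG : G.Connected)
    (hr : ∀ x y, G.Adj x y → ∃ e, s(a e, b e) = s(x, y))
    (h : Fintype.card V = Fintype.card E + 1) :
    ((signedIncidence a b ε)ᵀ * signedIncidence a b ε).det = Fintype.card V := by
  obtain ⟨φ⟩ := nonempty_equiv_of_card h
  obtain ⟨r⟩ := hG.nonempty
  obtain ⟨s, c, hc, hs, hsq⟩ := exists_vecMul_eq_zero_of_connected a b ε hG hr (by omega)
  set B := signedIncidence a b ε
  have h1 := sq_det_gram_of_vecMul_eq_zero φ B s (Pi.single r 1) hs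
  rw [det_gram_fromCols_single a b ε hG hr φ r, dotProduct_single_one, mul_one,
    dotProduct_self_of_sq_eq hsq, mul_pow, hsq] at h1
  have hne : (Bᵀ * B).det ≠ 0 := by
    rw [Ne, det_gram_eq_zero_iff]
    rintro ⟨x, hx0, hx⟩
    have h2 := det_gram_fromCols_single a b ε hG hr φ r
    have h3 : ∃ y, y ≠ 0 ∧ fromCols B (replicateCol Unit (Pi.single r (1 : ℤ))) *ᵥ y = 0 := by
      refine ⟨Sum.elim x 0, ?_, ?_⟩
      · intro h4
        exact hx0 (funext fun e => congrFun h4 (Sum.inl e))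
      · rw [fromCols_mulVec_sumElim, hx, mulVec_zero, add_zero]
    rw [(det_gram_eq_zero_iff _).mpr h3] at h2
    exact zero_ne_one h2
  have hc2 : c ^ 2 ≠ 0 := pow_ne_zero 2 hc
  apply mul_left_cancel₀ (mul_ne_zero hne hc2)
  -- With `g = det (BᵀB)`, `h1` reads `g² c² = g |V| c²`; the nonzero factor `g c²` has been
  -- cancelled.
  linear_combination h1

end Incidence

/-! ### Cycles, balance and the values 0 and 4 -/

section Cycles

variable {V E : Type*} {a b : E → V}

lemma exists_spanningTree [Fintype V] [Fintype E] [DecidableEq E] {G : SimpleGraph V}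
    (hG : G.Connected) (hr : ∀ x y, G.Adj x y → ∃ e, s(a e, b e) = s(x, y)) :
    ∃ (T : SimpleGraph V) (S : Finset E), T.Connected ∧ S.card + 1 = Fintype.card V ∧
      ∀ x y, T.Adj x y → ∃ e ∈ S, s(a e, b e) = s(x, y) := by
  classical
  obtain ⟨T, hle, hT⟩ := hG.exists_isTree_le
  have h1 : ∀ t : T.edgeSet, ∃ e, s(a e, b e) = t.1 := by
    rintro ⟨t, ht⟩
    induction t with
    | h x y => exact hr x y (hle ht)
  choose f hf using h1
  have hinj : Function.Injective f := fun t t' h => Subtype.ext (by rw [← hf, ← hf, h])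
  refine ⟨T, Finset.univ.image f, hT.connected, ?_, ?_⟩
  · rw [Finset.card_image_of_injective _ hinj, Finset.card_univ, ← hT.card_edgeFinset,
      SimpleGraph.edgeFinset_card]
  · intro x y hxy
    exact ⟨f ⟨s(x, y), hxy⟩, Finset.mem_image_of_mem _ (Finset.mem_univ _), hf _⟩

lemma card_le_card_add_one_of_connected [Fintype V] [Fintype E] {G : SimpleGraph V}
    (hG : G.Connected) (hr : ∀ x y, G.Adj x y → ∃ e, s(a e, b e) = s(x, y)) :
    Fintype.card V ≤ Fintype.card E + 1 := by
  classical
  obtain ⟨T, S, -, hS, -⟩ := exists_spanningTree hG hr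
  rw [← hS]
  exact Nat.add_le_add_right S.card_le_univ 1

/-- A spanning tree uses only `|V| - 1` edges, so some edge is left over. -/
lemma exists_removable_edge [Fintype V] [Fintype E] {G : SimpleGraph V}
    (hG : G.Connected) (hr : ∀ x y, G.Adj x y → ∃ e, s(a e, b e) = s(x, y))
    (h : Fintype.card V ≤ Fintype.card E) :
    ∃ (T : SimpleGraph V) (e₀ : E), T.Connected ∧
      ∀ x y, T.Adj x y → ∃ e, e ≠ e₀ ∧ s(a e, b e) = s(x, y) := by
  classical
  obtain ⟨T, S, hT, hS, hTS⟩ := exists_spanningTree hG hr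
  obtain ⟨e₀, he₀⟩ : ∃ e₀, e₀ ∉ S := by
    by_contra! hall
    rw [Finset.eq_univ_iff_forall.mpr hall, Finset.card_univ] at hS
    omega
  refine ⟨T, e₀, hT, fun x y hxy => ?_⟩
  obtain ⟨e, he, hxy⟩ := hTS x y hxy
  exact ⟨e, fun h => he₀ (h ▸ he), hxy⟩

/-- An edge whose ends are connected without it lies on a cycle. -/
lemma exists_isCyclicWalk_of_removable {T : SimpleGraph V} {e₀ : E} (hT : T.Connected)
    (hr : ∀ x y, T.Adj x y → ∃ e, e ≠ e₀ ∧ s(a e, b e) = s(x, y)) (hne : a e₀ ≠ b e₀) :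
    ∃ (k : ℕ) (v : Fin (k + 2) → V) (e : Fin (k + 2) → E), IsCyclicWalk a b v e := by
  obtain ⟨p, hp⟩ := hT.exists_isPath (a e₀) (b e₀)
  obtain ⟨k, hk⟩ : ∃ k, p.length = k + 1 := by
    cases hl : p.length with
    | zero => exact absurd (SimpleGraph.Walk.eq_of_length_eq_zero hl) hne
    | succ k => exact ⟨k, rfl⟩
  have hadj : ∀ i : Fin (k + 1), T.Adj (p.getVert i) (p.getVert (i + 1)) :=
    fun i => p.adj_getVert_succ (by omega)
  choose f hf0 hf using fun i => hr _ _ (hadj i)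
  have hvinj : ∀ i j : ℕ, i ≤ k + 1 → j ≤ k + 1 → p.getVert i = p.getVert j → i = j := by
    intro i j hi hj hij
    exact hp.getVert_injOn (by simp; omega) (by simp; omega) hij
  -- The path from `a e₀` to `b e₀` is closed up by `e₀`, which takes the last index, where `i + 1`
  -- wraps around to `0`.
  refine ⟨k, fun i => p.getVert i, Fin.lastCases e₀ f, ?_, ?_, ?_⟩
  · intro i j hij
    exact Fin.ext (hvinj i j (by omega) (by omega) hij)
  · intro i j hij
    induction i using Fin.lastCases with
    | last =>
      induction j using Fin.lastCases with
      | last => rfl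
      | cast j =>
        simp only [Fin.lastCases_last, Fin.lastCases_castSucc] at hij
        exact absurd hij.symm (hf0 j)
    | cast i =>
      induction j using Fin.lastCases with
      | last =>
        simp only [Fin.lastCases_last, Fin.lastCases_castSucc] at hij
        exact absurd hij (hf0 i)
      | cast j =>
        simp only [Fin.lastCases_castSucc] at hij
        have h1 := hf i
        rw [hij, hf j] at h1
        congr 1
        apply Fin.ext
        have hi := i.isLt
        have hj := j.isLt
        rcases Sym2.eq_iff.mp h1 with ⟨h2, -⟩ | ⟨h2, h3⟩
        · exact (hvinj _ _ (by omega) (by omega) h2).symm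
        -- The reversed matching of ends would give both `j = i + 1` and `j + 1 = i`.
        · have := hvinj _ _ (by omega) (by omega) h2
          have := hvinj _ _ (by omega) (by omega) h3
          omega
  · intro i
    induction i using Fin.lastCases with
    | last =>
      rw [Fin.lastCases_last, Fin.last_add_one, Sym2.eq_swap]
      have h1 : p.getVert (k + 1) = b e₀ := by rw [← hk, p.getVert_length]
      simp [h1]
    | cast i =>
      rw [Fin.lastCases_castSucc, hf, Fin.coeSucc_eq_succ]
      rfl

/-- Take the partial products of `η`; total product `1` is what makes the relation hold at the
wrap-around index. -/
lemma exists_cumulative_product {M : Type*} [Group M] {m : ℕ} (η : Fin (m + 1) → M)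
    (h : Fin.partialProd η (Fin.last (m + 1)) = 1) :
    ∃ c : Fin (m + 1) → M, ∀ i, c (i + 1) = c i * η i := by
  refine ⟨fun i => Fin.partialProd η i.castSucc, fun i => ?_⟩
  rw [← Fin.partialProd_succ]
  induction i using Fin.lastCases with
  | last => rw [Fin.last_add_one]; exact (Fin.partialProd_zero η).trans h.symm
  | cast i => rw [Fin.coeSucc_eq_succ, Fin.succ_castSucc]

lemma partialProd_last {M : Type*} [CommMonoid M] {m : ℕ} (η : Fin m → M) :
    Fin.partialProd η (Fin.last m) = ∏ i, η i := by
  rw [Fin.partialProd, Fin.val_last, List.take_of_length_le (by simp), List.prod_ofFn]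

lemma eq_prod_mul_of_cyclic {m : ℕ} (η : Fin (m + 1) → ℤ) (f : Fin (m + 1) → ℤ)
    (h : ∀ i, f i = η i * f (i + 1)) : f 0 = (∏ i, η i) * f 0 := by
  have key : ∀ i : Fin (m + 1), f 0 = Fin.partialProd η i.castSucc * f i := by
    intro i
    induction i using Fin.induction with
    | zero => simp
    | succ i ih =>
      rw [ih, h, ← mul_assoc, ← Fin.partialProd_succ, Fin.coeSucc_eq_succ, Fin.succ_castSucc]
  have h1 := key (Fin.last m)
  rwa [h (Fin.last m), ← mul_assoc, ← Fin.partialProd_succ, Fin.succ_last, Fin.last_add_one,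
    partialProd_last] at h1

variable [DecidableEq V] {ε : E → ℤˣ}

/-- The columns of the edges of a cycle with an even number of negative signs are dependent. -/
theorem det_gram_signedIncidence_of_balanced_cycle [Fintype V] [Fintype E] [DecidableEq E] {k : ℕ}
    {v : Fin (k + 2) → V} {e : Fin (k + 2) → E} (hc : IsCyclicWalk a b v e)
    (hprod : ∏ i, ε (e i) = 1) :
    ((signedIncidence a b ε)ᵀ * signedIncidence a b ε).det = 0 := by
  rw [det_gram_eq_zero_iff]
  obtain ⟨c, hcum⟩ := exists_cumulative_product (fun i => ε (e i)) (by rw [partialProd_last, hprod])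
  -- Scaled by `c i * δ`, the column of `e i` becomes a difference that telescopes around the cycle;
  -- `δ` corrects for the orientation in which the cycle traverses the edge.
  have hcol : ∀ i, ∃ δ : ℤˣ, signedIncidence a b ε *ᵥ Pi.single (e i) ((c i * δ : ℤˣ) : ℤ) =
      (c i : ℤ) • Pi.single (v i) (1 : ℤ) - (c (i + 1) : ℤ) • Pi.single (v (i + 1)) (1 : ℤ) := by
    intro i
    have h0 : ∀ z : ℤ, signedIncidence a b ε *ᵥ Pi.single (e i) z =
        z • (Pi.single (a (e i)) 1 - (ε (e i) : ℤ) • Pi.single (b (e i)) (1 : ℤ)) := by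
      intro z
      rw [← signedIncidence_col, mulVec_single]
      ext w
      simp [mul_comm]
    have hsq : (ε (e i) : ℤ) * ε (e i) = 1 := by
      rcases Int.units_eq_one_or (ε (e i)) with h1 | h1 <;> simp [h1]
    rcases Sym2.eq_iff.mp (hc.joins i) with ⟨h1, h2⟩ | ⟨h1, h2⟩
    · refine ⟨1, ?_⟩
      rw [h0, h1, h2, hcum, mul_one, smul_sub, smul_smul, Units.val_mul]
    · refine ⟨-ε (e i), ?_⟩
      rw [h0, h1, h2, hcum, smul_sub, smul_smul]
      push_cast
      rw [mul_neg, neg_mul, mul_assoc, hsq, mul_one, neg_smul, neg_smul]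
      abel
  choose δ hδ using hcol
  refine ⟨∑ i, Pi.single (e i) ((c i * δ i : ℤˣ) : ℤ), ?_, ?_⟩
  · intro h
    have h1 := congrFun h (e 0)
    rw [Finset.sum_apply, Finset.sum_eq_single 0, Pi.single_eq_same, Pi.zero_apply] at h1
    · exact (c 0 * δ 0).ne_zero h1
    · intro j _ hj
      exact Pi.single_eq_of_ne (fun h => hj (hc.injective_edges h.symm)) _
    · simp
  · rw [mulVec_sum, Finset.sum_congr rfl fun i _ => hδ i, Finset.sum_sub_distrib, sub_eq_zero]
    exact (Equiv.sum_comp (Equiv.addRight (1 : Fin (k + 2)))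
      fun i => (c i : ℤ) • (Pi.single (v i) (1 : ℤ) : V → ℤ)).symm

/-- A connected signed graph with as many edges as vertices has Gram determinant `0` or `4`. -/
lemma det_gram_signedIncidence_of_card_eq [Fintype V] [Fintype E] [DecidableEq E]
    {T : SimpleGraph V} {e₀ : E} (hT : T.Connected)
    (hr : ∀ x y, T.Adj x y → ∃ e, e ≠ e₀ ∧ s(a e, b e) = s(x, y))
    (h : Fintype.card V = Fintype.card E) :
    ((signedIncidence a b ε)ᵀ * signedIncidence a b ε).det = 0 ∨
      ((signedIncidence a b ε)ᵀ * signedIncidence a b ε).det = 4 := by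
  set E' := {e // e ≠ e₀}
  have hcard : Fintype.card V = Fintype.card E' + 1 := by
    rw [h, Fintype.card_subtype_compl, Fintype.card_subtype_eq, Nat.sub_add_cancel]
    exact Fintype.card_pos_iff.mpr ⟨e₀⟩
  have hr' : ∀ x y, T.Adj x y → ∃ e : E', s(a e, b e) = s(x, y) := by
    intro x y hxy
    obtain ⟨e, he, h1⟩ := hr x y hxy
    exact ⟨⟨e, he⟩, h1⟩
  obtain ⟨φ⟩ := nonempty_equiv_of_card hcard
  obtain ⟨s, c, hc, hs, hsq⟩ := exists_vecMul_eq_zero_of_connected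
    (fun e : E' => a e) (fun e : E' => b e) (fun e : E' => ε e) hT hr' (by omega)
  have hdet := det_gram_signedIncidence_of_card_eq_add_one
    (fun e : E' => a e) (fun e : E' => b e) (fun e : E' => ε e) hT hr' hcard
  set α : V → ℤ := fun v => signedIncidence a b ε v e₀
  have h1 := sq_det_gram_of_vecMul_eq_zero φ _ s α hs
  let ψ : E' ⊕ Unit ≃ E := (Equiv.optionEquivSumPUnit _).symm.trans (Equiv.optionSubtypeNe e₀)
  have h2 : fromCols (signedIncidence (fun e : E' => a e) (fun e : E' => b e)
      (fun e : E' => ε e)) (replicateCol Unit α) = (signedIncidence a b ε).submatrix id ψ := by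
    have hψl : ∀ j, ψ (Sum.inl j) = j := fun j => Equiv.optionSubtypeNe_some e₀ j
    have hψr : ∀ j, ψ (Sum.inr j) = e₀ := fun j => Equiv.optionSubtypeNe_none e₀
    ext i (j | j)
    · simp [hψl, signedIncidence]
    · simp [hψr, α]
  rw [h2, transpose_submatrix, ← submatrix_mul _ _ _ _ _ Function.bijective_id,
    det_submatrix_equiv_self, hdet, dotProduct_self_of_sq_eq hsq] at h1
  have hα : s ⬝ᵥ α = s (a e₀) - ε e₀ * s (b e₀) := vecMul_signedIncidence a b ε s e₀
  set g := ((signedIncidence a b ε)ᵀ * signedIncidence a b ε).det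
  have hn : (Fintype.card V : ℤ) ≠ 0 := by rw [hcard]; positivity
  have hc2 : c ^ 2 ≠ 0 := pow_ne_zero 2 hc
  have h3 : (s ⬝ᵥ α) ^ 2 = c ^ 2 * g := by
    apply mul_left_cancel₀ (pow_ne_zero 2 hn)
    linear_combination h1
  -- Both entries of `s` are `±c`, so `s ⬝ᵥ α` is `0` or `±2c`, a root of `x (x² - 4c²)`.
  have h4 : (s (a e₀) - ε e₀ * s (b e₀)) * ((s (a e₀) - ε e₀ * s (b e₀)) ^ 2 - 4 * c ^ 2) = 0 := by
    have ha := hsq (a e₀)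
    have hb := hsq (b e₀)
    have hε : (ε e₀ : ℤ) ^ 2 = 1 := by
      rcases Int.units_eq_one_or (ε e₀) with h1 | h1 <;> simp [h1]
    linear_combination (s (a e₀) - 3 * (ε e₀ : ℤ) * s (b e₀)) * ha
      + (3 * s (a e₀) * (ε e₀ : ℤ) ^ 2 - (ε e₀ : ℤ) ^ 3 * s (b e₀)) * hb
      + (3 * s (a e₀) - (ε e₀ : ℤ) * s (b e₀)) * c ^ 2 * hε
  rw [← hα] at h4
  rcases mul_eq_zero.mp h4 with h5 | h5
  · left
    rw [h5] at h3
    exact (mul_eq_zero.mp (h3.symm.trans (zero_pow two_ne_zero))).resolve_left hc2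
  · right
    apply mul_left_cancel₀ hc2
    linear_combination h5 - h3

/-- Going once around the cycle, a vector `s` orthogonal to all columns satisfies `s (v 0) = -s (v
0)`, so it vanishes there. Its squares are constant on the connected graph, so `s = 0` and the
square incidence matrix is nonsingular. -/
lemma det_gram_ne_zero_of_unbalanced_cycle [Fintype V] [Fintype E] [DecidableEq E]
    {G : SimpleGraph V} (hG : G.Connected)
    (hr : ∀ x y, G.Adj x y → ∃ e, s(a e, b e) = s(x, y))
    (h : Fintype.card V = Fintype.card E) {k : ℕ}
    {v : Fin (k + 2) → V} {e : Fin (k + 2) → E} (hc : IsCyclicWalk a b v e)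
    (hprod : ∏ i, ε (e i) = -1) :
    ((signedIncidence a b ε)ᵀ * signedIncidence a b ε).det ≠ 0 := by
  obtain ⟨φ⟩ := Fintype.card_eq.mp h
  set B := signedIncidence a b ε
  have h1 : Bᵀ * B = (B.submatrix φ.symm id)ᵀ * B.submatrix φ.symm id := by
    rw [transpose_submatrix, submatrix_mul_equiv, submatrix_id_id]
  rw [h1, det_mul, det_transpose]
  refine mul_self_ne_zero.mpr fun h0 => ?_
  obtain ⟨s', hs0, hs'⟩ := exists_vecMul_eq_zero_iff.mpr h0
  set s : V → ℤ := s' ∘ φ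
  have hs : s ᵥ* B = 0 := by
    rw [← hs']
    ext j
    simp only [vecMul, dotProduct, submatrix_apply, id]
    rw [← φ.symm.sum_comp]
    simp [s]
  have hcyc : ∀ i, s (v i) = ((ε (e i) : ℤˣ) : ℤ) * s (v (i + 1)) := by
    intro i
    have h2 := congrFun hs (e i)
    rw [vecMul_signedIncidence, Pi.zero_apply] at h2
    have hsq : (ε (e i) : ℤ) * ε (e i) = 1 := by
      rcases Int.units_eq_one_or (ε (e i)) with h1 | h1 <;> simp [h1]
    rcases Sym2.eq_iff.mp (hc.joins i) with ⟨h3, h4⟩ | ⟨h3, h4⟩ <;> rw [h3, h4] at h2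
    · linear_combination h2
    · linear_combination -(ε (e i) : ℤ) * h2 - s (v i) * hsq
  have h2 := eq_prod_mul_of_cyclic _ _ hcyc
  rw [← Units.coe_prod, hprod] at h2
  have h3 : s (v 0) = 0 := by
    push_cast at h2
    omega
  apply hs0
  ext j
  have h4 := sq_eq_of_vecMul_eq_zero a b ε hG hr hs (v 0) (φ.symm j)
  rw [h3, zero_pow two_ne_zero] at h4
  simpa [s] using h4

/-- A connected graph with one more vertex than edges has no cycles. -/
lemma not_isCyclicWalk_of_card_eq_add_one [Fintype V] [Fintype E] {G : SimpleGraph V}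
    (hG : G.Connected) (hr : ∀ x y, G.Adj x y → ∃ e, s(a e, b e) = s(x, y))
    (h : Fintype.card V = Fintype.card E + 1) {k : ℕ} {v : Fin (k + 2) → V} {e : Fin (k + 2) → E} :
    ¬ IsCyclicWalk a b v e := by
  classical
  intro hc
  -- Acyclicity does not involve signs. With all signs `1` any cycle is balanced and forces Gram
  -- determinant `0`, whereas the tree formula gives `|V| > 0`.
  have h1 := det_gram_signedIncidence_of_balanced_cycle (ε := fun _ => 1) hc (by simp)
  rw [det_gram_signedIncidence_of_card_eq_add_one a b _ hG hr h] at h1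
  omega

end Cycles

lemma Matrix.det_eq_prod_det_toSquareBlock {m α R : Type*} [Fintype m] [DecidableEq m] [Fintype α]
    [DecidableEq α] [CommRing R] (M : Matrix m m R) (b : m → α)
    (h : ∀ i j, b i ≠ b j → M i j = 0) : M.det = ∏ k, (M.toSquareBlock b k).det := by
  classical
  -- Any linear order on the block labels turns a block diagonal matrix into a block triangular one.
  let _ : LinearOrder α := linearOrderOfSTO WellOrderingRel
  convert BlockTriangular.det_fintype (M := M) (b := b) fun i j hij => h i j hij.ne'

/-! ### Components of signed graphs and their Gram determinants -/

namespace TypeD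

variable {n : ℕ}

namespace SignedEdge

/-- The sign of an edge: `-1` for a `+`-edge and `1` for a `-`-edge, so that the vector of the edge
`(pq)_s` is `u_p - sign • u_q`. -/
def sign (e : SignedEdge n) : ℤˣ := if e.isPlus then -1 else 1

lemma fst_ne_snd (e : SignedEdge n) : e.fst ≠ e.snd := e.2.ne

lemma joins_iff (e : SignedEdge n) (x y : Fin n) :
    e.Joins x y ↔ s(e.fst, e.snd) = s(x, y) := by
  rw [Sym2.eq_iff, Joins]

lemma prod_sign (Z : Finset (SignedEdge n)) :
    ∏ e ∈ Z, e.sign = (-1) ^ (Z.filter fun e => e.isPlus = true).card := by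
  simp only [sign]
  rw [Finset.prod_ite, Finset.prod_const, Finset.prod_const_one, mul_one]

end SignedEdge

namespace SignedGraph

/-- The signed incidence matrix of `F`. -/
abbrev incidence (F : SignedGraph n) : Matrix (Fin n) F ℤ :=
  signedIncidence (fun e => e.1.fst) (fun e => e.1.snd) (fun e => e.1.sign)

/-- The Gram determinant of the vectors `u_p ± u_q` of the edges of `F`. -/
def gramDet (F : SignedGraph n) : ℤ := (F.incidenceᵀ * F.incidence).det

lemma adj_of_mem {F : SignedGraph n} {e : SignedEdge n} (he : e ∈ F) :
    F.toSimpleGraph.Adj e.fst e.snd := by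
  rw [toSimpleGraph, SimpleGraph.fromRel_adj]
  exact ⟨e.fst_ne_snd, Or.inl ⟨e, he, Or.inl ⟨rfl, rfl⟩⟩⟩

lemma exists_mem_of_adj {F : SignedGraph n} {x y : Fin n} (h : F.toSimpleGraph.Adj x y) :
    ∃ e ∈ F, s(e.fst, e.snd) = s(x, y) := by
  rw [toSimpleGraph, SimpleGraph.fromRel_adj] at h
  rcases h.2 with ⟨e, he, hj⟩ | ⟨e, he, hj⟩
  · exact ⟨e, he, (e.joins_iff x y).mp hj⟩
  · exact ⟨e, he, ((e.joins_iff y x).mp hj).trans Sym2.eq_swap⟩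

variable (F : SignedGraph n)

/-- The component that contains the edge `e`. -/
def componentOf (e : F) : F.Component := F.toSimpleGraph.connectedComponentMk e.1.fst

lemma componentOf_eq_snd (e : F) :
    F.componentOf e = F.toSimpleGraph.connectedComponentMk e.1.snd :=
  SimpleGraph.ConnectedComponent.eq.mpr (adj_of_mem e.2).reachable

lemma connectedComponentMk_eq_of_incidence_ne_zero {v : Fin n} {e : F}
    (h : F.incidence v e ≠ 0) : F.toSimpleGraph.connectedComponentMk v = F.componentOf e := by
  by_cases h1 : v = e.1.fst
  · rw [h1, componentOf]
  by_cases h2 : v = e.1.snd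
  · rw [h2, componentOf_eq_snd]
  · simp [signedIncidence, h1, h2] at h

/-- The edges of the component `K`, as a subtype of the edges of `F`. -/
abbrev ComponentEdge (K : F.Component) : Type := {e : F // F.componentOf e = K}

variable {F} (K : F.Component)

/-- The smaller end of an edge of `K`. -/
def componentFst (e : F.ComponentEdge K) : K :=
  ⟨e.1.1.fst, SimpleGraph.ConnectedComponent.mem_supp_iff K _ |>.mpr e.2⟩

/-- The larger end of an edge of `K`. -/
def componentSnd (e : F.ComponentEdge K) : K :=
  ⟨e.1.1.snd, SimpleGraph.ConnectedComponent.mem_supp_iff K _ |>.mpr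
    ((F.componentOf_eq_snd e.1).symm.trans e.2)⟩

/-- The signed incidence matrix of the component `K`. -/
abbrev componentIncidence : Matrix K (F.ComponentEdge K) ℤ :=
  signedIncidence (componentFst K) (componentSnd K) (fun e => e.1.1.sign)

lemma exists_componentEdge_of_adj (x y : K) (h : K.toSimpleGraph.Adj x y) :
    ∃ e, s(componentFst K e, componentSnd K e) = s(x, y) := by
  obtain ⟨e, he, hxy⟩ := exists_mem_of_adj (F := F) (x := x) (y := y) h
  have hx : F.toSimpleGraph.connectedComponentMk x.1 = K := x.2
  have hy : F.toSimpleGraph.connectedComponentMk y.1 = K := y.2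
  have hK : F.componentOf ⟨e, he⟩ = K := by
    rw [componentOf]
    rcases Sym2.eq_iff.mp hxy with ⟨h1, -⟩ | ⟨h1, -⟩ <;> rw [h1] <;> assumption
  refine ⟨⟨⟨e, he⟩, hK⟩, ?_⟩
  rw [Sym2.eq_iff] at hxy ⊢
  simp only [Subtype.ext_iff]
  exact hxy

lemma mem_edgesOf (e : SignedEdge n) :
    e ∈ F.edgesOf K ↔ ∃ he : e ∈ F, F.componentOf ⟨e, he⟩ = K := by
  simp [edgesOf, componentOf]

lemma card_componentEdge [Fintype (F.ComponentEdge K)] :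
    Fintype.card (F.ComponentEdge K) = (F.edgesOf K).card := by
  rw [← Fintype.card_coe]
  refine Fintype.card_congr ⟨fun e => ⟨e.1.1, (mem_edgesOf K _).mpr ⟨e.1.2, e.2⟩⟩,
    fun e => ⟨⟨e.1, ((mem_edgesOf K _).mp e.2).1⟩, ((mem_edgesOf K _).mp e.2).2⟩, ?_, ?_⟩
  · intro e; rfl
  · intro e; rfl

lemma card_component [Fintype K] : Fintype.card K = K.supp.ncard := by
  rw [← Nat.card_coe_set_eq, Nat.card_eq_fintype_card]
  rfl

/-- The cycles of the graph `F` and those of its incidence structure are the same. -/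
lemma exists_isCyclicWalk_of_isCycle {Z : Finset (SignedEdge n)} (hZF : Z ⊆ F) (hZ : IsCycle Z) :
    ∃ (k : ℕ) (v : Fin (k + 2) → Fin n) (e : Fin (k + 2) → F),
      IsCyclicWalk (fun e : F => e.1.fst) (fun e : F => e.1.snd) v e ∧
        Z = Finset.univ.image fun i => (e i).1 := by
  obtain ⟨k, v, e, hv, he, hj, rfl⟩ := hZ
  refine ⟨k, v, fun i => ⟨e i, hZF (Finset.mem_image_of_mem _ (Finset.mem_univ _))⟩,
    ⟨hv, fun i j hij => he (congrArg Subtype.val hij), fun i => ?_⟩, rfl⟩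
  exact ((e i).joins_iff _ _).mp (hj i)

lemma exists_isCyclicWalk_of_isCycle_component {Z : Finset (SignedEdge n)}
    (hZF : Z ⊆ F.edgesOf K) (hZ : IsCycle Z) :
    ∃ (k : ℕ) (v : Fin (k + 2) → K) (e : Fin (k + 2) → F.ComponentEdge K),
      IsCyclicWalk (componentFst K) (componentSnd K) v e := by
  obtain ⟨k, v, e, hv, he, hj, rfl⟩ := hZ
  have hmem : ∀ i, ∃ h : e i ∈ F, F.componentOf ⟨e i, h⟩ = K :=
    fun i => (mem_edgesOf K _).mp (hZF (Finset.mem_image_of_mem _ (Finset.mem_univ _)))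
  choose h1 h2 using hmem
  have hvK : ∀ i, F.toSimpleGraph.connectedComponentMk (v i) = K := by
    intro i
    rcases hj i with ⟨h, -⟩ | ⟨-, h⟩
    · rw [← h, ← h2 i, componentOf]
    · rw [← h, ← h2 i, componentOf_eq_snd]
  refine ⟨k, fun i => ⟨v i, hvK i⟩, fun i => ⟨⟨e i, h1 i⟩, h2 i⟩, ?_, ?_, fun i => ?_⟩
  · intro i j hij
    exact hv (congrArg Subtype.val hij)
  · intro i j hij
    exact he (congrArg (fun e => e.1.1) hij)
  · have h := ((e i).joins_iff _ _).mp (hj i)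
    rw [Sym2.eq_iff] at h ⊢
    simp only [Subtype.ext_iff]
    exact h

lemma isCycle_of_isCyclicWalk {k : ℕ} {v : Fin (k + 2) → K} {e : Fin (k + 2) → F.ComponentEdge K}
    (hc : IsCyclicWalk (componentFst K) (componentSnd K) v e) :
    (Finset.univ.image fun i => (e i).1.1) ⊆ F.edgesOf K ∧
      IsCycle (Finset.univ.image fun i => (e i).1.1) := by
  constructor
  · intro x hx
    obtain ⟨i, -, rfl⟩ := Finset.mem_image.mp hx
    exact (mem_edgesOf K _).mpr ⟨(e i).1.2, (e i).2⟩
  · refine ⟨k, fun i => (v i).1, fun i => (e i).1.1, ?_, ?_, fun i => ?_, rfl⟩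
    · exact Subtype.val_injective.comp hc.injective_vertices
    · exact Subtype.val_injective.comp (Subtype.val_injective.comp hc.injective_edges)
    · rw [SignedEdge.joins_iff]
      have h := hc.joins i
      rw [Sym2.eq_iff] at h ⊢
      simp only [Subtype.ext_iff] at h
      exact h

lemma edgesOf_subset : F.edgesOf K ⊆ F := fun _ he => ((mem_edgesOf K _).mp he).1

lemma prod_sign_image {k : ℕ} {e : Fin (k + 2) → SignedEdge n} (he : Function.Injective e) :
    ∏ i, (e i).sign =
      (-1) ^ ((Finset.univ.image e).filter fun e => e.isPlus = true).card := by
  rw [← SignedEdge.prod_sign, Finset.prod_image he.injOn]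

lemma gramDet_eq_zero_of_not_oddCycles (h : ¬ F.OddCycles) : F.gramDet = 0 := by
  simp only [OddCycles, not_forall, Nat.not_odd_iff_even] at h
  obtain ⟨Z, hZF, hZ, heven⟩ := h
  obtain ⟨k, v, e, hc, rfl⟩ := exists_isCyclicWalk_of_isCycle hZF hZ
  refine det_gram_signedIncidence_of_balanced_cycle hc ?_
  rw [prod_sign_image (e := fun i => (e i).1) (Subtype.val_injective.comp hc.injective_edges)]
  exact heven.neg_one_pow

/-- Vertices outside `K` are not incident to edges of `K`, so they add nothing to the inner
products. -/
lemma toSquareBlock_gram [Fintype K] :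
    (F.incidenceᵀ * F.incidence).toSquareBlock F.componentOf K =
      (componentIncidence K)ᵀ * componentIncidence K := by
  classical
  ext e e'
  have hterm : ∀ (v : K) (e : F.ComponentEdge K),
      componentIncidence K v e = F.incidence v e.1 := by
    intro v e
    simp [signedIncidence, componentFst, componentSnd, Subtype.ext_iff]
  rw [toSquareBlock_def, of_apply, mul_apply, mul_apply]
  simp only [transpose_apply, hterm]
  rw [← Finset.sum_subtype (Finset.univ.filter fun v => v ∈ K) (by simp)
    fun v => F.incidence v e.1 * F.incidence v e'.1]
  refine (Finset.sum_filter_of_ne fun v _ hv => ?_).symm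
  exact (F.connectedComponentMk_eq_of_incidence_ne_zero (left_ne_zero_of_mul hv)).trans e.2

variable [Fintype K] [Fintype (F.ComponentEdge K)]

/-- With at least as many edges as vertices, an edge outside a spanning tree closes a cycle; the
converse is `not_isCyclicWalk_of_card_eq_add_one`. -/
lemma isTree_iff : F.IsTree K ↔ K.supp.ncard = (F.edgesOf K).card + 1 := by
  rw [← card_component, ← card_componentEdge]
  have hconn := K.connected_toSimpleGraph
  have hr := exists_componentEdge_of_adj K
  constructor
  · intro hK
    refine le_antisymm (card_le_card_add_one_of_connected hconn hr) ?_
    by_contra! hlt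
    obtain ⟨T, e₀, hT, hTr⟩ := exists_removable_edge hconn hr (by omega)
    obtain ⟨k, v, e, hc⟩ := exists_isCyclicWalk_of_removable hT hTr
      (fun h => e₀.1.1.fst_ne_snd (congrArg Subtype.val h))
    exact hK _ (isCycle_of_isCyclicWalk K hc).1 (isCycle_of_isCyclicWalk K hc).2
  · intro hcard Z hZF hZ
    obtain ⟨k, v, e, hc⟩ := exists_isCyclicWalk_of_isCycle_component K hZF hZ
    exact not_isCyclicWalk_of_card_eq_add_one hconn hr hcard hc

lemma ncard_supp_le : K.supp.ncard ≤ (F.edgesOf K).card + 1 := by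
  rw [← card_component, ← card_componentEdge]
  exact card_le_card_add_one_of_connected K.connected_toSimpleGraph
    (exists_componentEdge_of_adj K)

lemma det_gram_componentIncidence_of_isTree (h : F.IsTree K) :
    ((componentIncidence K)ᵀ * componentIncidence K).det = ((F.edgesOf K).card : ℤ) + 1 := by
  have h1 := (isTree_iff K).mp h
  rw [det_gram_signedIncidence_of_card_eq_add_one _ _ _ K.connected_toSimpleGraph
    (exists_componentEdge_of_adj K) (by rw [card_component, card_componentEdge, h1]),
    card_component, h1]
  push_cast
  rfl

lemma det_gram_componentIncidence_of_isOneCycle (h : F.IsOneCycle K)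
    (hodd : F.OddCycles) :
    ((componentIncidence K)ᵀ * componentIncidence K).det = 4 := by
  have hcard : Fintype.card K = Fintype.card (F.ComponentEdge K) := by
    rw [card_component, card_componentEdge]
    exact h
  have hconn := K.connected_toSimpleGraph
  have hr := exists_componentEdge_of_adj K
  obtain ⟨T, e₀, hT, hTr⟩ := exists_removable_edge hconn hr hcard.le
  obtain ⟨k, v, e, hc⟩ := exists_isCyclicWalk_of_removable hT hTr
    (fun h => e₀.1.1.fst_ne_snd (congrArg Subtype.val h))
  refine (det_gram_signedIncidence_of_card_eq hT hTr hcard).resolve_left ?_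
  refine det_gram_ne_zero_of_unbalanced_cycle hconn hr hcard hc ?_
  rw [prod_sign_image (e := fun i => (e i).1.1)
    (Subtype.val_injective.comp (Subtype.val_injective.comp hc.injective_edges))]
  obtain ⟨h1, h2⟩ := isCycle_of_isCyclicWalk K hc
  exact (hodd _ (h1.trans (edgesOf_subset K)) h2).neg_one_pow

/-- By connectedness, a component that is neither a tree nor one-cycle has more edges than vertices.
-/
lemma det_gram_componentIncidence_of_not (h : ¬ F.IsTree K)
    (h' : ¬ F.IsOneCycle K) :
    ((componentIncidence K)ᵀ * componentIncidence K).det = 0 := by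
  apply det_gram_eq_zero_of_card_lt
  rw [card_component, card_componentEdge]
  rw [isTree_iff] at h
  rw [IsOneCycle] at h'
  have := ncard_supp_le K
  omega

end SignedGraph

end TypeD

/-! ### The Gram determinant of a whole graph -/

namespace TypeD

variable {n : ℕ}

namespace SignedGraph

variable (F : SignedGraph n)

/-- Edges in different components share no vertex, so their columns are orthogonal. -/
lemma gramDet_eq_prod [Fintype F.Component] [∀ K : F.Component, Fintype K]
    [∀ K : F.Component, Fintype (F.ComponentEdge K)] :
    F.gramDet = ∏ K : F.Component, ((componentIncidence K)ᵀ * componentIncidence K).det := by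
  classical
  rw [gramDet, Matrix.det_eq_prod_det_toSquareBlock _ F.componentOf]
  · refine Finset.prod_congr rfl fun K _ => ?_
    rw [toSquareBlock_gram]
    congr!
  · intro e e' hne
    rw [mul_apply]
    refine Finset.sum_eq_zero fun v _ => ?_
    by_contra h
    exact hne ((F.connectedComponentMk_eq_of_incidence_ne_zero (left_ne_zero_of_mul h)).symm.trans
      (F.connectedComponentMk_eq_of_incidence_ne_zero (right_ne_zero_of_mul h)))

lemma mem_treeComponents (K : F.Component) : K ∈ F.treeComponents ↔ F.IsTree K := by
  simp [treeComponents]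

lemma mem_oneCycleComponents (K : F.Component) :
    K ∈ F.oneCycleComponents ↔ F.IsOneCycle K := by
  simp [oneCycleComponents]

variable {F}

lemma not_isTree_of_isOneCycle {K : F.Component} (h : F.IsOneCycle K) : ¬ F.IsTree K := by
  classical
  have := Fintype.ofFinite K
  rw [isTree_iff]
  rw [IsOneCycle] at h
  omega

lemma gramDet_of_isMixedForest (h : F.IsMixedForest) (hodd : F.OddCycles) :
    F.gramDet = 4 ^ F.oneCycleComponents.card *
      ∏ K ∈ F.treeComponents, (((F.edgesOf K).card : ℤ) + 1) := by
  classical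
  have := Fintype.ofFinite F.Component
  have := fun K : F.Component => Fintype.ofFinite K
  rw [gramDet_eq_prod, ← Finset.prod_mul_prod_compl F.treeComponents, mul_comm]
  congr 1
  · have hcompl : F.treeComponentsᶜ = F.oneCycleComponents := by
      ext K
      rw [Finset.mem_compl, mem_treeComponents, mem_oneCycleComponents]
      exact ⟨(h K).resolve_left, not_isTree_of_isOneCycle⟩
    rw [hcompl, Finset.prod_congr rfl fun K hK =>
      det_gram_componentIncidence_of_isOneCycle K ((F.mem_oneCycleComponents K).mp hK) hodd,
      Finset.prod_const]
  · exact Finset.prod_congr rfl fun K hK =>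
      det_gram_componentIncidence_of_isTree K ((F.mem_treeComponents K).mp hK)

lemma gramDet_of_not_isMixedForest (h : ¬ F.IsMixedForest) : F.gramDet = 0 := by
  classical
  have := Fintype.ofFinite F.Component
  have := fun K : F.Component => Fintype.ofFinite K
  simp only [IsMixedForest, not_forall, not_or] at h
  obtain ⟨K, h1, h2⟩ := h
  rw [gramDet_eq_prod]
  exact Finset.prod_eq_zero (Finset.mem_univ K) (det_gram_componentIncidence_of_not K h1 h2)

/-- In a mixed forest the numbers of edges and of tree components add up to the number of
vertices. -/
lemma card_treeComponents_add_card (h : F.IsMixedForest) :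
    F.treeComponents.card + F.card = n := by
  classical
  have := Fintype.ofFinite F.Component
  have := fun K : F.Component => Fintype.ofFinite K
  have hV : n = ∑ K : F.Component, K.supp.ncard := by
    refine (Fintype.card_fin n).symm.trans ?_
    rw [← Fintype.card_congr (Equiv.sigmaFiberEquiv F.toSimpleGraph.connectedComponentMk),
      Fintype.card_sigma]
    refine Finset.sum_congr rfl fun K _ => ?_
    rw [← card_component]
    exact Fintype.card_congr (Equiv.refl _)
  have hE : F.card = ∑ K : F.Component, (F.edgesOf K).card := by
    rw [← Fintype.card_coe, ← Fintype.card_congr (Equiv.sigmaFiberEquiv F.componentOf),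
      Fintype.card_sigma]
    exact Finset.sum_congr rfl fun K _ => card_componentEdge K
  have hK : ∀ K : F.Component,
      K.supp.ncard = (F.edgesOf K).card + if K ∈ F.treeComponents then 1 else 0 := by
    intro K
    split_ifs with hK
    · exact (isTree_iff K).mp ((F.mem_treeComponents K).mp hK)
    · exact (h K).resolve_left fun ht => hK ((F.mem_treeComponents K).mpr ht)
  rw [Finset.sum_congr rfl fun K _ => hK K, Finset.sum_add_distrib, ← hE, Finset.sum_ite_mem,
    Finset.univ_inter, Finset.sum_const, smul_eq_mul, mul_one] at hV
  omega

lemma card_oneCycleComponents_le (F : SignedGraph n) : F.oneCycleComponents.card ≤ n := by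
  classical
  have := Fintype.ofFinite F.Component
  calc F.oneCycleComponents.card ≤ Fintype.card F.Component := Finset.card_le_univ _
    _ ≤ Fintype.card (Fin n) := Fintype.card_le_of_surjective
        F.toSimpleGraph.connectedComponentMk Quot.mk_surjective
    _ = n := Fintype.card_fin n

end SignedGraph

/-! ### The sum `μ_k` in terms of Gram determinants -/

open Classical in
/-- The sum `μ_k` as a sum of weighted Gram determinants over all graphs with `k` edges. -/
lemma mu_eq_sum_gramDet (cminus cplus : Fin n → Fin n → ℝ) (k : ℕ) :
    mu cminus cplus k = ∑ F ∈ (Finset.univ : Finset (SignedEdge n)).powersetCard k,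
      (∏ e ∈ F, SignedEdge.weight cminus cplus e) * (SignedGraph.gramDet F : ℝ) := by
  set P : SignedGraph n → Prop := fun F => F.IsMixedForest ∧ F.OddCycles
  rw [← Finset.sum_filter_of_ne (p := P)]
  swap
  · intro F _ hF
    have hF : F.gramDet ≠ 0 := by exact_mod_cast right_ne_zero_of_mul hF
    exact ⟨by_contra fun h => hF (SignedGraph.gramDet_of_not_isMixedForest h),
      by_contra fun h => hF (SignedGraph.gramDet_eq_zero_of_not_oddCycles h)⟩
  rw [← Finset.sum_fiberwise_of_maps_to (t := Finset.range (n + 1))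
    (g := fun F : SignedGraph n => F.oneCycleComponents.card)
    fun F _ => Finset.mem_range_succ_iff.mpr F.card_oneCycleComponents_le]
  refine Finset.sum_congr rfl fun l _ => ?_
  have hset : MFD n k l =
      {F ∈ (Finset.univ.powersetCard k).filter P | F.oneCycleComponents.card = l} := by
    ext F
    simp only [MFD, Finset.mem_filter, Finset.mem_univ, true_and, Finset.mem_powersetCard,
      Finset.subset_univ, P]
    constructor
    · rintro ⟨h1, h2, h3, -, h5⟩
      exact ⟨⟨h3, h1, h2⟩, h5⟩
    · rintro ⟨⟨h3, h1, h2⟩, h5⟩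
      -- In a mixed forest with `k` edges the count of tree components required by `MFD` is
      -- automatic.
      exact ⟨h1, h2, h3, h3 ▸ SignedGraph.card_treeComponents_add_card h1, h5⟩
  rw [hset]
  refine Finset.sum_congr rfl fun F hF => ?_
  simp only [Finset.mem_filter, P] at hF
  obtain ⟨⟨-, h1, h2⟩, rfl⟩ := hF
  rw [SignedGraph.gramDet_of_isMixedForest h1 h2]
  push_cast
  ring

/-! ### The operator as `B W Bᵀ` and its characteristic polynomial -/

/-- The signed incidence matrix of the graph of all edges. -/
abbrev fullIncidence (n : ℕ) : Matrix (Fin n) (SignedEdge n) ℤ :=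
  signedIncidence SignedEdge.fst SignedEdge.snd SignedEdge.sign

lemma one_sub_sigma_apply {p q : Fin n} (hpq : p ≠ q) (x : Fin n → ℝ) :
    (1 - sigma p q) x = (x p - x q) • (u p - u q) := by
  suffices h : 1 - sigma p q =
      (LinearMap.proj (R := ℝ) (φ := fun _ : Fin n => ℝ) p - LinearMap.proj q).smulRight
        (u p - u q) by
    rw [h]; rfl
  refine (Pi.basisFun ℝ (Fin n)).ext fun i => ?_
  rw [LinearMap.sub_apply, sigma, Module.Basis.constr_basis]
  by_cases hp : i = p
  · subst hp; simp [u, hpq.symm]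
  by_cases hq : i = q
  · subst hq; simp [u, hpq, hp]
  · simp [u, hp, hq, Ne.symm hp, Ne.symm hq]

lemma one_sub_tau_apply {p q : Fin n} (hpq : p ≠ q) (x : Fin n → ℝ) :
    (1 - tau p q) x = (x p + x q) • (u p + u q) := by
  suffices h : 1 - tau p q =
      (LinearMap.proj (R := ℝ) (φ := fun _ : Fin n => ℝ) p + LinearMap.proj q).smulRight
        (u p + u q) by
    rw [h]; rfl
  refine (Pi.basisFun ℝ (Fin n)).ext fun i => ?_
  rw [LinearMap.sub_apply, tau, Module.Basis.constr_basis]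
  by_cases hp : i = p
  · subst hp; simp [u, hpq.symm]
  by_cases hq : i = q
  · subst hq; simp [u, hpq, hp, add_comm]
  · simp [u, hp, hq, Ne.symm hp, Ne.symm hq]

lemma sum_signedEdge {M : Type*} [AddCommMonoid M] (f : Fin n × Fin n × Bool → M) :
    ∑ e : SignedEdge n, f e.1 =
      ∑ p, ∑ q ∈ Finset.Ioi p, (f (p, q, false) + f (p, q, true)) := by
  rw [← Finset.sum_subtype (Finset.univ.filter fun e : Fin n × Fin n × Bool => e.1 < e.2.1)
    (by simp) f, Finset.sum_filter, Fintype.sum_prod_type]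
  refine Finset.sum_congr rfl fun p _ => ?_
  rw [Fintype.sum_prod_type, ← Finset.filter_lt_eq_Ioi, Finset.sum_filter]
  refine Finset.sum_congr rfl fun q _ => ?_
  rw [Fintype.sum_bool]
  split_ifs <;> simp [add_comm]

/-- The summand of the operator that belongs to the signed edge `e`. -/
noncomputable def edgeOperator (cminus cplus : Fin n → Fin n → ℝ) (e : Fin n × Fin n × Bool) :
    Module.End ℝ (Fin n → ℝ) :=
  if e.2.2 then cplus e.1 e.2.1 • (1 - tau e.1 e.2.1) else cminus e.1 e.2.1 • (1 - sigma e.1 e.2.1)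

lemma cast_fullIncidence_apply (v : Fin n) (e : SignedEdge n) :
    (fullIncidence n v e : ℝ) = u e.fst v - ((e.sign : ℤ) : ℝ) * u e.snd v := by
  simp [signedIncidence, u, Pi.single_apply]

/-- The summand of `e` is the rank-one matrix `w b bᵀ`, with `w` the weight and `b` the column of
`e`. -/
lemma edgeOperator_single (cminus cplus : Fin n → Fin n → ℝ) (e : SignedEdge n) (i j : Fin n) :
    edgeOperator cminus cplus e.1 (Pi.single i 1) j =
      (fullIncidence n j e : ℝ) * (e.weight cminus cplus * (fullIncidence n i e : ℝ)) := by
  have hne : e.1.1 ≠ e.1.2.1 := e.fst_ne_snd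
  have hi : ∀ p, (Pi.single i (1 : ℝ) : Fin n → ℝ) p = u p i := fun p => by
    simp [u, Pi.single_apply, eq_comm]
  rw [cast_fullIncidence_apply, cast_fullIncidence_apply]
  by_cases h : e.1.2.2 = true
  · simp only [edgeOperator, SignedEdge.weight, SignedEdge.isPlus, h, if_true, LinearMap.smul_apply,
      one_sub_tau_apply hne, SignedEdge.sign, SignedEdge.fst, SignedEdge.snd, hi, Pi.smul_apply,
      Pi.add_apply, smul_eq_mul]
    push_cast
    ring
  · simp only [edgeOperator, SignedEdge.weight, SignedEdge.isPlus, h, if_false,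
      LinearMap.smul_apply, one_sub_sigma_apply hne, SignedEdge.sign, SignedEdge.fst,
      SignedEdge.snd, hi, Pi.smul_apply, Pi.sub_apply, smul_eq_mul, Bool.false_eq_true]
    push_cast
    ring

/-- The operator is `B W Bᵀ` for the signed incidence matrix `B` and the diagonal matrix `W` of
the weights. -/
lemma toMatrix'_operator (cminus cplus : Fin n → Fin n → ℝ) :
    LinearMap.toMatrix' (operator cminus cplus) =
      (fullIncidence n).map (Int.cast : ℤ → ℝ) *
        (diagonal (SignedEdge.weight cminus cplus) *
          ((fullIncidence n).map (Int.cast : ℤ → ℝ))ᵀ) := by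
  have h : operator cminus cplus = ∑ e : SignedEdge n, edgeOperator cminus cplus e.1 := by
    rw [sum_signedEdge, operator]
    simp [edgeOperator]
  ext j i
  rw [LinearMap.toMatrix'_apply, h, LinearMap.sum_apply, Finset.sum_apply, mul_apply]
  refine Finset.sum_congr rfl fun e _ => ?_
  rw [edgeOperator_single, diagonal_mul, transpose_apply, map_apply, map_apply]

lemma submatrix_gram_fullIncidence (F : SignedGraph n) :
    ((((fullIncidence n).map (Int.cast : ℤ → ℝ))ᵀ *
      (fullIncidence n).map (Int.cast : ℤ → ℝ)).submatrix (Subtype.val : F → SignedEdge n) Subtype.val).det = F.gramDet := by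
  rw [SignedGraph.gramDet, ← eq_intCast (Int.castRingHom ℝ), RingHom.map_det]
  congr 1
  ext e e'
  simp [mul_apply, signedIncidence]

/-- With `N` possible edges, `X^N charpoly (B W Bᵀ) = X^n charpoly (W Bᵀ B)`. Comparing coefficients
at `N + n - k` leads to the principal `k × k` minors of `W Bᵀ B`, from which the diagonal factor `W`
splits off. -/
lemma coeff_charpoly_operator (cminus cplus : Fin n → Fin n → ℝ) {k : ℕ} (hk : k ≤ n) :
    (operator cminus cplus).charpoly.coeff (n - k) = (-1) ^ k * mu cminus cplus k := by
  classical
  set B := (fullIncidence n).map (Int.cast : ℤ → ℝ)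
  set W : Matrix (SignedEdge n) (SignedEdge n) ℝ := diagonal (SignedEdge.weight cminus cplus)
  have h1 : (operator cminus cplus).charpoly = (B * (W * Bᵀ)).charpoly := by
    rw [← LinearMap.charpoly_toMatrix _ (Pi.basisFun ℝ (Fin n))]
    congr 1
    exact toMatrix'_operator cminus cplus
  set N := Fintype.card (SignedEdge n)
  have h2 := charpoly_mul_comm' B (W * Bᵀ)
  rw [Fintype.card_fin] at h2
  have h3 : (operator cminus cplus).charpoly.coeff (n - k) =
      (X ^ n * (W * Bᵀ * B).charpoly).coeff (N + n - k) := by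
    rw [h1, ← h2, show N + n - k = n - k + N by omega, coeff_X_pow_mul]
  rw [h3, mu_eq_sum_gramDet]
  by_cases hkN : k ≤ N
  · rw [show N + n - k = N - k + n by omega, coeff_X_pow_mul, charpoly_coeff_eq_sum_minors _ _ hkN]
    congr 1
    refine Finset.sum_congr (by congr!) fun F _ => ?_
    rw [← submatrix_gram_fullIncidence, ← Finset.prod_coe_sort, ← det_diagonal, ← det_mul,
      Matrix.mul_assoc]
    congr 1
    ext e e'
    simp [W, diagonal_mul, B]
  -- For `k > N` no graph has `k` edges, and `N + n - k < n` lies below the factor `X^n`.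
  · rw [Finset.powersetCard_eq_empty.mpr (by rw [Finset.card_univ]; omega), Finset.sum_empty,
      mul_zero, coeff_X_pow_mul', if_neg (by omega)]

end TypeD

theorem mainTheorem4 (n : ℕ) (cminus cplus : Fin n → Fin n → ℝ) :
    (TypeD.operator cminus cplus).charpoly =
      ∑ k ∈ Finset.range (n + 1),
        C ((-1) ^ k * TypeD.mu cminus cplus k) * X ^ (n - k) := by
  have hdeg : (TypeD.operator cminus cplus).charpoly.natDegree < n + 1 := by
    rw [LinearMap.charpoly_natDegree, Module.finrank_fin_fun]
    exact Nat.lt_succ_self n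
  rw [(TypeD.operator cminus cplus).charpoly.as_sum_range_C_mul_X_pow' hdeg,
    ← Finset.sum_range_reflect]
  refine Finset.sum_congr rfl fun k hk => ?_
  rw [Nat.add_sub_cancel, TypeD.coeff_charpoly_operator cminus cplus
    (Nat.lt_succ_iff.mp (Finset.mem_range.mp hk))]
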